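/- Let $(d_k)_{k\ge 1}$, $(\hat d_k)_{k\ge 1}$, $(\beta_k)_{k\ge 1}$ be sequences of positive numbers with $\sum_{k} d_k<\infty$, and let $C_1,C_2>0$ and $\alpha\ge 3$ be real numbers such that, for all $k\ge 1$, $$\hat d_k\le C_1\min\{d_k,d_{k+1}\},\qquad \beta_k\le C_2(\hat d_k)^{\alpha},\qquad C_2\le \frac1{C_1}\Bigl(\max_{j\ge 1}\hat d_j\Bigr)^{1-\alpha}.$$ Put $x_k:=\sum_{j=1}^{k}(d_j+\hat d_j)-\hat d_k$ and define the rooms and passages $$R_k:=(x_k-d_k,x_k)\times\Bigl(-\tfrac{d_k}2,\tfrac{d_k}2\Bigr),\qquad P_k:=[x_k,x_k+\hat d_k]\times\Bigl(-\tfrac{\beta_k}2,\tfrac{\beta_k}2\Bigr),\qquad \Omega:=\bigcup_{k\ge 1}(R_k\cup P_k)\subset\mathbb R^2 .$$ Then: 1. $\Omega$ is open, connected and bounded. 2. The embedding $H^1(\Omega)\hookrightarrow L^2(\Omega)$ is not compact. Here $L^2(\Omega)$ is the space of complex square integrable functions, and $H^1(\Omega)$ is the space of $u\in L^2(\Omega)$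 with first order weak derivatives in $L^2(\Omega)$, normed by $\|u\|_{H^1}^2=\|u\|_{L^2}^2+\|\nabla u\|_{L^2}^2$. 3. Let $A_\Omega$ be the Neumann Laplacian on $\Omega$, that is, the operator in $L^2(\Omega)$ associated with the form $\mathfrak a_\Omega[u,v]=\int_\Omega\nabla u\cdot\overline{\nabla v}\,dx$ on $H^1(\Omega)$: its domain consists of all $u\in H^1(\Omega)$ for which there is $f\in L^2(\Omega)$ with $(f,v)_{L^2(\Omega)}=\mathfrak a_\Omega[u,v]$ for all $v\in H^1(\Omega)$, and then $A_\Omega u=f$. The operator $A_\Omega$ is self-adjoint, and its essential spectrum $\sigma_{\mathrm{ess}}(A_\Omega)$ is not empty. Here $\sigma_{\mathrm{ess}}(A_\Omega)$ is the set of all points of the spectrum of $A_\Omega$ that are not isolated points of the spectrum which are eigenvalues with finite-dimensional eigenspace. -/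

import Mathlib

open MeasureTheory
open scoped ContDiff ENNReal

namespace RoomsPassages

/-! ### First order Sobolev space of a planar set -/

/-- The complex Hilbert space `L²(Ω)`, with respect to Lebesgue measure on `Ω ⊆ ℝ²`. -/
abbrev L2 (Ω : Set (ℝ × ℝ)) : Type := Lp ℂ 2 (volume.restrict Ω)

/-- `φ` is a (real valued) test function on `Ω`, that is, `φ ∈ C_c^∞(Ω)`. -/
structure IsTestFunction (Ω : Set (ℝ × ℝ)) (φ : ℝ × ℝ → ℝ) : Prop where
  contDiff : ContDiff ℝ ∞ φ
  hasCompactSupport : HasCompactSupport φ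
  tsupport_subset : tsupport φ ⊆ Ω

/-- `g` is the weak derivative of `u` on `Ω` in the direction `e`. -/
def HasWeakPartial (Ω : Set (ℝ × ℝ)) (e : ℝ × ℝ) (u g : L2 Ω) : Prop :=
  ∀ φ : ℝ × ℝ → ℝ, IsTestFunction Ω φ →
    ∫ z in Ω, (fderiv ℝ φ z e) • u z = - ∫ z in Ω, φ z • g z

section aux

variable {Ω : Set (ℝ × ℝ)} {φ : ℝ × ℝ → ℝ}

theorem IsTestFunction.continuous_fderiv_apply (hφ : IsTestFunction Ω φ) (e : ℝ × ℝ) :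
    Continuous fun z => fderiv ℝ φ z e :=
  (hφ.contDiff.continuous_fderiv (by simp)).clm_apply continuous_const

theorem IsTestFunction.hasCompactSupport_fderiv_apply (hφ : IsTestFunction Ω φ) (e : ℝ × ℝ) :
    HasCompactSupport fun z => fderiv ℝ φ z e :=
  hφ.hasCompactSupport.fderiv_apply ℝ e

theorem integrable_smul_L2 {ψ : ℝ × ℝ → ℝ} (hc : Continuous ψ) (hs : HasCompactSupport ψ)
    (u : L2 Ω) : Integrable (fun z => ψ z • u z) (volume.restrict Ω) := by
  have h1 : MemLp ψ 2 (volume.restrict Ω) := hc.memLp_of_hasCompactSupport hs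
  exact memLp_one_iff_integrable.mp ((Lp.memLp u).smul h1)

theorem HasWeakPartial.zero (e : ℝ × ℝ) : HasWeakPartial Ω e 0 0 := by
  intro φ _
  have h0 := Lp.coeFn_zero ℂ 2 (volume.restrict Ω)
  rw [integral_congr_ae (g := fun _ => (0 : ℂ)) (by filter_upwards [h0] with z hz; rw [hz]; simp),
    integral_congr_ae (f := fun z => φ z • (0 : L2 Ω) z) (g := fun _ => (0 : ℂ))
      (by filter_upwards [h0] with z hz; rw [hz]; simp)]
  simp

theorem HasWeakPartial.add {e : ℝ × ℝ} {u g v h : L2 Ω} (hu : HasWeakPartial Ω e u g)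
    (hv : HasWeakPartial Ω e v h) : HasWeakPartial Ω e (u + v) (g + h) := by
  intro φ hφ
  have hc := hφ.continuous_fderiv_apply e
  have hs := hφ.hasCompactSupport_fderiv_apply e
  rw [integral_congr_ae (g := fun z => (fderiv ℝ φ z e) • u z + (fderiv ℝ φ z e) • v z)
      (by filter_upwards [Lp.coeFn_add u v] with z hz; rw [hz, Pi.add_apply, smul_add]),
    integral_congr_ae (f := fun z => φ z • (g + h) z) (g := fun z => φ z • g z + φ z • h z)
      (by filter_upwards [Lp.coeFn_add g h] with z hz; rw [hz, Pi.add_apply, smul_add]),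
    integral_add (integrable_smul_L2 hc hs u) (integrable_smul_L2 hc hs v),
    integral_add (integrable_smul_L2 hφ.contDiff.continuous hφ.hasCompactSupport g)
      (integrable_smul_L2 hφ.contDiff.continuous hφ.hasCompactSupport h), hu φ hφ, hv φ hφ]
  ring

theorem HasWeakPartial.smul {e : ℝ × ℝ} {u g : L2 Ω} (c : ℂ) (hu : HasWeakPartial Ω e u g) :
    HasWeakPartial Ω e (c • u) (c • g) := by
  intro φ hφ
  rw [integral_congr_ae (g := fun z => c • ((fderiv ℝ φ z e) • u z))
      (by filter_upwards [Lp.coeFn_smul c u] with z hz; rw [hz, Pi.smul_apply, smul_comm]),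
    integral_congr_ae (f := fun z => φ z • (c • g) z) (g := fun z => c • (φ z • g z))
      (by filter_upwards [Lp.coeFn_smul c g] with z hz; rw [hz, Pi.smul_apply, smul_comm]),
    integral_smul, integral_smul, hu φ hφ, smul_neg]

end aux

/-- The Sobolev space `H¹(Ω)`. A function `u ∈ H¹(Ω)` is stored together with its (unique) weak
gradient, as the triple `(u, ∂₁u, ∂₂u)`. The norm inherited from the `ℓ²` product is the usual one,
`‖u‖²_{H¹} = ‖u‖² + ‖∂₁u‖² + ‖∂₂u‖²`. -/
def H1 (Ω : Set (ℝ × ℝ)) : Submodule ℂ (PiLp 2 fun _ : Fin 3 => L2 Ω) where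
  carrier := {U | HasWeakPartial Ω (1, 0) (U 0) (U 1) ∧ HasWeakPartial Ω (0, 1) (U 0) (U 2)}
  zero_mem' := ⟨HasWeakPartial.zero _, HasWeakPartial.zero _⟩
  add_mem' hU hV := ⟨hU.1.add hV.1, hU.2.add hV.2⟩
  smul_mem' c _ hU := ⟨hU.1.smul c, hU.2.smul c⟩

/-- The embedding `H¹(Ω) ↪ L²(Ω)`. -/
noncomputable def embedding (Ω : Set (ℝ × ℝ)) : H1 Ω →L[ℂ] L2 Ω :=
  (PiLp.proj 2 (𝕜 := ℂ) (fun _ : Fin 3 => L2 Ω) 0).comp (H1 Ω).subtypeL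

/-! ### The Neumann Laplacian -/

/-- The form `a[u, v] = ∫_Ω ∇u · conj ∇v` on `H¹(Ω)`. (Mathlib's inner products are conjugate linear
in the first argument.) -/
noncomputable def neumannForm (Ω : Set (ℝ × ℝ)) (U V : H1 Ω) : ℂ :=
  inner ℂ (V.1 1) (U.1 1) + inner ℂ (V.1 2) (U.1 2)

/-- All pairs `(u, f) ∈ L²(Ω) × L²(Ω)` with `u ∈ H¹(Ω)` and `(f, v)_{L²} = a[u, v]` for all
`v ∈ H¹(Ω)`. -/
def neumannGraph (Ω : Set (ℝ × ℝ)) : Submodule ℂ (L2 Ω × L2 Ω) where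
  carrier := {p | ∃ U : H1 Ω, embedding Ω U = p.1 ∧
    ∀ V : H1 Ω, inner ℂ (embedding Ω V) p.2 = neumannForm Ω U V}
  zero_mem' := ⟨0, by simp, fun V => by simp [neumannForm]⟩
  add_mem' := by
    rintro p q ⟨U, hU, hU'⟩ ⟨V, hV, hV'⟩
    refine ⟨U + V, by simp [hU, hV], fun W => ?_⟩
    simp only [Prod.snd_add, inner_add_right, hU', hV', neumannForm, Submodule.coe_add,
      PiLp.add_apply]
    ring
  smul_mem' := by
    rintro c p ⟨U, hU, hU'⟩
    refine ⟨c • U, by simp [hU], fun W => ?_⟩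
    simp only [Prod.smul_snd, inner_smul_right, hU', neumannForm, Submodule.coe_smul,
      PiLp.smul_apply]
    ring

/-- The Neumann Laplacian `A_Ω`, the operator in `L²(Ω)` associated with the form `a`: its domain
consists of all `u ∈ H¹(Ω)` for which there is `f ∈ L²(Ω)` with `(f, v) = a[u, v]` for all
`v ∈ H¹(Ω)`, and then `A_Ω u = f`. -/
noncomputable def neumannLaplacian (Ω : Set (ℝ × ℝ)) : L2 Ω →ₗ.[ℂ] L2 Ω :=
  (neumannGraph Ω).toLinearPMap

section wellDefined

variable {Ω : Set (ℝ × ℝ)}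

theorem locallyIntegrableOn_L2 (f : L2 Ω) : LocallyIntegrableOn (f : ℝ × ℝ → ℂ) Ω
    (volume.restrict Ω) :=
  ((Lp.memLp f).locallyIntegrable (by norm_num)).locallyIntegrableOn Ω

/-- Fundamental lemma of the calculus of variations in `L²(Ω)`. -/
theorem eq_zero_of_forall_testFunction (hΩ : IsOpen Ω) {f : L2 Ω}
    (h : ∀ φ, IsTestFunction Ω φ → ∫ z in Ω, φ z • f z = 0) : f = 0 := by
  have key := hΩ.ae_eq_zero_of_integral_contDiff_smul_eq_zero (locallyIntegrableOn_L2 f)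
    fun φ h1 h2 h3 => h φ ⟨h1, h2, h3⟩
  rw [Lp.eq_zero_iff_ae_eq_zero]
  filter_upwards [key, ae_restrict_mem hΩ.measurableSet] with z hz hzΩ
  exact hz hzΩ

/-- Weak derivatives are unique. -/
theorem HasWeakPartial.unique (hΩ : IsOpen Ω) {e : ℝ × ℝ} {u g h : L2 Ω}
    (hg : HasWeakPartial Ω e u g) (hh : HasWeakPartial Ω e u h) : g = h := by
  have hd : HasWeakPartial Ω e (u + (-1 : ℂ) • u) (g + (-1 : ℂ) • h) := hg.add (hh.smul (-1))
  have hu : u + (-1 : ℂ) • u = 0 := by simp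
  rw [hu] at hd
  have h0 : g + (-1 : ℂ) • h = 0 := by
    refine eq_zero_of_forall_testFunction hΩ fun φ hφ => ?_
    have h1 := hd φ hφ
    rw [integral_congr_ae (g := fun _ => (0 : ℂ))
      (by filter_upwards [Lp.coeFn_zero ℂ 2 (volume.restrict Ω)] with z hz; rw [hz]; simp)] at h1
    simpa using h1.symm
  simpa [← sub_eq_add_neg, sub_eq_zero] using h0

/-- The embedding of `H¹(Ω)` into `L²(Ω)` is injective. -/
theorem embedding_injective (hΩ : IsOpen Ω) : Function.Injective (embedding Ω) := by
  intro U V hUV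
  have h0 : U.1 0 = V.1 0 := hUV
  have h1 : U.1 1 = V.1 1 := HasWeakPartial.unique hΩ U.2.1 (h0 ▸ V.2.1)
  have h2 : U.1 2 = V.1 2 := HasWeakPartial.unique hΩ U.2.2 (h0 ▸ V.2.2)
  ext i : 2
  fin_cases i
  · exact h0
  · exact h1
  · exact h2

theorem memLp_ofReal {ψ : ℝ × ℝ → ℝ} (hc : Continuous ψ) (hs : HasCompactSupport ψ) :
    MemLp (fun z => (ψ z : ℂ)) 2 (volume.restrict Ω) :=
  (Complex.continuous_ofReal.comp hc).memLp_of_hasCompactSupport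
    (hs.comp_left (g := fun x : ℝ => (x : ℂ)) Complex.ofReal_zero)

theorem IsTestFunction.hasWeakPartial {φ : ℝ × ℝ → ℝ} (hφ : IsTestFunction Ω φ) (e : ℝ × ℝ) :
    HasWeakPartial Ω e (memLp_ofReal hφ.contDiff.continuous hφ.hasCompactSupport).toLp
      (memLp_ofReal (hφ.continuous_fderiv_apply e) (hφ.hasCompactSupport_fderiv_apply e)).toLp := by
  intro ψ hψ
  rw [integral_congr_ae (g := fun z => ((fderiv ℝ ψ z e * φ z : ℝ) : ℂ))
      (by filter_upwards [MemLp.coeFn_toLp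
            (memLp_ofReal (Ω := Ω) hφ.contDiff.continuous hφ.hasCompactSupport)] with z hz
          rw [hz]; simp),
    integral_congr_ae (f := fun z => ψ z • _) (g := fun z => ((ψ z * fderiv ℝ φ z e : ℝ) : ℂ))
      (by filter_upwards [MemLp.coeFn_toLp (memLp_ofReal (Ω := Ω) (hφ.continuous_fderiv_apply e)
            (hφ.hasCompactSupport_fderiv_apply e))] with z hz
          rw [hz]; simp),
    integral_complex_ofReal, integral_complex_ofReal, ← Complex.ofReal_neg]
  congr 1
  have hz : ∀ z ∉ Ω, ψ z = 0 := fun z hz =>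
    image_eq_zero_of_notMem_tsupport fun h => hz (hψ.tsupport_subset h)
  have hz' : ∀ z ∉ Ω, φ z = 0 := fun z hz =>
    image_eq_zero_of_notMem_tsupport fun h => hz (hφ.tsupport_subset h)
  rw [setIntegral_eq_integral_of_forall_compl_eq_zero fun z h => by simp [hz' z h],
    setIntegral_eq_integral_of_forall_compl_eq_zero fun z h => by simp [hz z h]]
  have hψd : Differentiable ℝ ψ := hψ.contDiff.differentiable (by simp)
  have hφd : Differentiable ℝ φ := hφ.contDiff.differentiable (by simp)
  have := integral_mul_fderiv_eq_neg_fderiv_mul_of_integrable (μ := volume) (f := ψ) (g := φ)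
    (v := e)
    (((hψ.continuous_fderiv_apply e).mul hφ.contDiff.continuous).integrable_of_hasCompactSupport
      (hψ.hasCompactSupport_fderiv_apply e).mul_right)
    ((hψ.contDiff.continuous.mul (hφ.continuous_fderiv_apply e)).integrable_of_hasCompactSupport
      hψ.hasCompactSupport.mul_right)
    ((hψ.contDiff.continuous.mul hφ.contDiff.continuous).integrable_of_hasCompactSupport
      hψ.hasCompactSupport.mul_right)
    (fun x _ => hψd x) (fun x _ => hφd x)
  rw [this, neg_neg]

/-- For open `Ω` the relation defining the Neumann Laplacian is the graph of an operator, so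
`neumannLaplacian Ω` is the operator described in its definition. -/
theorem neumannLaplacian_graph (hΩ : IsOpen Ω) : (neumannLaplacian Ω).graph = neumannGraph Ω := by
  refine Submodule.toLinearPMap_graph_eq _ ?_
  rintro ⟨u, f⟩ ⟨U, hU, hU'⟩ hu
  obtain rfl : U = 0 := embedding_injective hΩ (by rw [hU, hu, map_zero])
  refine eq_zero_of_forall_testFunction hΩ fun φ hφ => ?_
  let V : H1 Ω := ⟨WithLp.toLp 2
    ![(memLp_ofReal hφ.contDiff.continuous hφ.hasCompactSupport).toLp,
      (memLp_ofReal (hφ.continuous_fderiv_apply (1, 0))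
        (hφ.hasCompactSupport_fderiv_apply (1, 0))).toLp,
      (memLp_ofReal (hφ.continuous_fderiv_apply (0, 1))
        (hφ.hasCompactSupport_fderiv_apply (0, 1))).toLp],
    hφ.hasWeakPartial (1, 0), hφ.hasWeakPartial (0, 1)⟩
  have hV : inner ℂ (embedding Ω V) f = 0 := by simpa [neumannForm] using hU' V
  have hV' : embedding Ω V
      = (memLp_ofReal (Ω := Ω) hφ.contDiff.continuous hφ.hasCompactSupport).toLp := rfl
  rw [hV', L2.inner_def] at hV
  rw [← hV]
  refine integral_congr_ae ?_
  filter_upwards [MemLp.coeFn_toLp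
    (memLp_ofReal (Ω := Ω) hφ.contDiff.continuous hφ.hasCompactSupport)] with z hz
  simp [hz, mul_comm]

end wellDefined

/-! ### Spectrum and essential spectrum of an unbounded operator -/

section Spectrum

variable {H : Type*} [NormedAddCommGroup H] [InnerProductSpace ℂ H]

/-- `A - z`, as a linear map on the domain of `A`. -/
def shift (A : H →ₗ.[ℂ] H) (z : ℂ) : A.domain →ₗ[ℂ] H :=
  A.toFun - z • A.domain.subtype

/-- The spectrum of `A`: all `z` such that `A - z` has no bounded, everywhere defined inverse. -/
def spectrumOp (A : H →ₗ.[ℂ] H) : Set ℂ :=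
  {z | ¬ ∃ R : H →L[ℂ] H, (∀ u : A.domain, R (shift A z u) = u) ∧
    ∀ f : H, ∃ u : A.domain, (u : H) = R f ∧ shift A z u = f}

/-- The discrete spectrum of `A`: the eigenvalues with finite dimensional eigenspace that are
isolated points of the spectrum. -/
def discreteSpectrum (A : H →ₗ.[ℂ] H) : Set ℂ :=
  {z | z ∈ spectrumOp A ∧ (∃ ε > 0, ∀ w ∈ spectrumOp A, dist w z < ε → w = z) ∧
    LinearMap.ker (shift A z) ≠ ⊥ ∧ FiniteDimensional ℂ (LinearMap.ker (shift A z))}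

/-- The essential spectrum of `A`: the complement of the discrete spectrum in the spectrum. -/
def essentialSpectrum (A : H →ₗ.[ℂ] H) : Set ℂ :=
  spectrumOp A \ discreteSpectrum A

end Spectrum

/-! ### The rooms-and-passages domain

The sequences are indexed from `0` here, so that `d k`, `dh k`, `β k` are the parameters of the
room and of the passage with number `k + 1`. -/

/-- The abscissa of the right end of the room with index `k`:
the sum of `d j + dh j` over `j ≤ k`, minus `dh k`. -/
noncomputable def abscissa (d dh : ℕ → ℝ) (k : ℕ) : ℝ :=
  ∑ j ∈ Finset.range (k + 1), (d j + dh j) - dh k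

/-- The room with index `k`, an open square of side `d k`. -/
noncomputable def room (d dh : ℕ → ℝ) (k : ℕ) : Set (ℝ × ℝ) :=
  Set.Ioo (abscissa d dh k - d k) (abscissa d dh k) ×ˢ Set.Ioo (-(d k / 2)) (d k / 2)

/-- The passage with index `k`, of length `dh k` and width `β k`, between the rooms `k`, `k + 1`. -/
noncomputable def passage (d dh β : ℕ → ℝ) (k : ℕ) : Set (ℝ × ℝ) :=
  Set.Icc (abscissa d dh k) (abscissa d dh k + dh k) ×ˢ Set.Ioo (-(β k / 2)) (β k / 2)

/-- The rooms-and-passages domain. -/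
noncomputable def domain (d dh β : ℕ → ℝ) : Set (ℝ × ℝ) :=
  ⋃ k, room d dh k ∪ passage d dh β k

end RoomsPassages

/-! Take a function that is 1 on one room, falls to 0 along the two adjacent passages, and vanishes
elsewhere. For the room of side `d (k + 1)` its squared `L²` norm is at least `d (k + 1) ^ 2`, while
its energy is of order `β k / dh k + β (k + 1) / dh (k + 1)`. Since `β ≤ C * dh ^ 3` and `dh` is at
most `C₁` times the side of either neighbouring room, the energy is at most a constant times `d (k +
1) ^ 2`. Every second such function gives disjoint supports; normalising yields a sequence
orthonormal in `L²` and bounded in `H¹` (`exists_orthonormal_bounded`), so the embedding `J` is not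
compact.

For the spectrum, put `T = J J*`, which is `(A + 1)⁻¹` (`isResolventAtNegOne_neumann`). It is
self-adjoint and injective, hence `A` is self-adjoint. If the essential spectrum were empty, the
nonzero spectrum of `T` would consist of isolated eigenvalues of finite multiplicity, and `T` would
be compact (`isCompactOperator_of_isolated_spectrum`). But on the orthonormal sequence `⟨e, T e⟩ =
‖J* e‖²` stays away from 0, which excludes this.

Topologically, the bound on `C₂` makes each passage no wider than its two rooms, so passages can be
prolonged into the rooms to form an open chain. -/

namespace RoomsPassages

/-! ### Operators with a bounded resolvent at `-1` -/

section Resolvent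

variable {H : Type*} [NormedAddCommGroup H] [InnerProductSpace ℂ H]

/-- `T` is the resolvent `(A + 1)⁻¹`, expressed through the graph of `A`. -/
def IsResolventAtNegOne (A : H →ₗ.[ℂ] H) (T : H →L[ℂ] H) : Prop :=
  ∀ u g : H, (u, g) ∈ A.graph ↔ T (g + u) = u

variable {A : H →ₗ.[ℂ] H} {T : H →L[ℂ] H}

theorem IsResolventAtNegOne.mem_graph (h : IsResolventAtNegOne A T) (f : H) :
    (T f, f - T f) ∈ A.graph := by
  rw [h]; simp

theorem IsResolventAtNegOne.mem_domain (h : IsResolventAtNegOne A T) (f : H) :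
    T f ∈ A.domain :=
  LinearPMap.mem_domain_of_mem_graph (h.mem_graph f)

theorem IsResolventAtNegOne.shift_apply (h : IsResolventAtNegOne A T) (z : ℂ) (f : H)
    (u : A.domain) (hu : (u : H) = T f) : shift A z u = f - (1 + z) • T f := by
  have h1 := h.mem_graph f
  rw [← hu] at h1
  have h2 : A u = f - u := A.mem_graph_snd_inj (A.mem_graph u) h1 rfl
  change A u - z • (u : H) = _
  rw [h2, hu, add_smul, one_smul]
  abel

theorem IsResolventAtNegOne.apply_map_add (h : IsResolventAtNegOne A T) (u : A.domain) :
    T (A u + u) = u :=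
  (h _ _).1 (A.mem_graph u)

/-- A vector orthogonal to the range of `T` is killed by `T`, so the domain is dense. The graph of
`A` is `{(T f, f - T f)}`; testing the adjoint relation on it and moving `T` across gives `T (g + u)
= u`, the graph condition again. -/
theorem IsResolventAtNegOne.isSelfAdjoint [CompleteSpace H] (h : IsResolventAtNegOne A T)
    (hT : IsSelfAdjoint T) (hinj : Function.Injective T) : IsSelfAdjoint A := by
  have hsymm : ∀ x y, inner ℂ (T x) y = inner ℂ x (T y) := hT.isSymmetric
  have hdense : Dense (A.domain : Set H) := by
    rw [Submodule.dense_iff_topologicalClosure_eq_top, Submodule.topologicalClosure_eq_top_iff,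
      Submodule.eq_bot_iff]
    intro v hv
    rw [Submodule.mem_orthogonal] at hv
    refine hinj ?_
    rw [map_zero]
    refine ext_inner_left ℂ fun f => ?_
    rw [inner_zero_right, ← hsymm]
    exact hv _ (h.mem_domain f)
  rw [LinearPMap.isSelfAdjoint_def]
  refine LinearPMap.eq_of_eq_graph ?_
  rw [LinearPMap.adjoint_graph_eq_graph_adjoint hdense]
  ext ⟨u, g⟩
  rw [Submodule.mem_adjoint_iff, h]
  constructor
  · intro hu
    refine ext_inner_left ℂ fun f => ?_
    have := hu _ _ (h.mem_graph f)
    simp only [inner_sub_left, hsymm] at this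
    rw [map_add, inner_add_right]
    rw [sub_sub, sub_eq_zero] at this
    rw [this, add_comm]
  · rintro hu a b hab
    rw [h] at hab
    have h1 : inner ℂ (T (b + a)) (g + u) = inner ℂ (b + a) (T (g + u)) := hsymm _ _
    rw [hab, hu, inner_add_right, inner_add_left] at h1
    linear_combination -h1

/-- If `R` inverts `A - (l⁻¹ - 1)`, then `l⁻¹ • (1 + l⁻¹ • R)` inverts `l - T`. -/
theorem IsResolventAtNegOne.mem_spectrumOp (h : IsResolventAtNegOne A T) {l : ℂ} (hl : l ≠ 0)
    (hlT : l ∈ spectrum ℂ T) : l⁻¹ - 1 ∈ spectrumOp A := by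
  rintro ⟨R, hR, hR'⟩
  refine hlT ?_
  have hS : ∀ f u, ((u : A.domain) : H) = T f → shift A (l⁻¹ - 1) u = f - l⁻¹ • T f := by
    intro f u hu
    rw [h.shift_apply _ f u hu]
    congr 2
    ring
  have hRT : ∀ f, R (f - l⁻¹ • T f) = T f := by
    intro f
    have := hR ⟨T f, h.mem_domain f⟩
    rwa [hS f _ rfl] at this
  have hTR : ∀ f, T (f + l⁻¹ • R f) = R f := by
    intro f
    obtain ⟨u, hu, hu'⟩ := hR' f
    have h1 := h.apply_map_add u
    have h2 : A u - (l⁻¹ - 1) • (u : H) = f := hu'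
    rw [← hu]
    convert h1 using 2
    rw [← h2, sub_smul, one_smul]
    abel
  refine isUnit_iff_exists.2 ⟨l⁻¹ • (1 + l⁻¹ • R), ?_, ?_⟩
  · ext f
    change l • (l⁻¹ • (f + l⁻¹ • R f)) - T (l⁻¹ • (f + l⁻¹ • R f)) = f
    rw [map_smul, hTR, smul_smul, mul_inv_cancel₀ hl, one_smul, add_sub_cancel_right]
  · ext f
    change l⁻¹ • ((l • f - T f) + l⁻¹ • R (l • f - T f)) = f
    have h3 : l • f - T f = l • (f - l⁻¹ • T f) := by
      rw [smul_sub, smul_smul, mul_inv_cancel₀ hl, one_smul]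
    rw [h3, map_smul, hRT, ← h3, smul_smul, inv_mul_cancel₀ hl, one_smul, sub_add_cancel,
      smul_smul, inv_mul_cancel₀ hl, one_smul]

theorem IsResolventAtNegOne.finiteDimensional_ker (h : IsResolventAtNegOne A T) {l : ℂ}
    (hl : l ≠ 0) (hfin : FiniteDimensional ℂ (LinearMap.ker (shift A (l⁻¹ - 1)))) :
    FiniteDimensional ℂ (LinearMap.ker (T - l • (1 : H →L[ℂ] H)).toLinearMap) := by
  have hle : LinearMap.ker (T - l • (1 : H →L[ℂ] H)).toLinearMap ≤
      (LinearMap.ker (shift A (l⁻¹ - 1))).map A.domain.subtype := by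
    intro v hv
    have hv' : T v = l • v := by simpa [sub_eq_zero] using hv
    have hv2 : v = T (l⁻¹ • v) := by
      rw [map_smul, hv', smul_smul, inv_mul_cancel₀ hl, one_smul]
    have hmem : v ∈ A.domain := hv2 ▸ h.mem_domain _
    refine ⟨⟨v, hmem⟩, ?_, rfl⟩
    change shift A _ _ = 0
    rw [h.shift_apply _ (l⁻¹ • v) _ hv2, ← hv2]
    rw [add_sub_cancel, sub_self]
  exact Submodule.finiteDimensional_of_le hle

end Resolvent

/-! ### Compactness of self-adjoint operators from their spectrum -/

section Compact

variable {H : Type*} [NormedAddCommGroup H] [InnerProductSpace ℂ H]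

theorem isCompactOperator_of_range_le {F : H →L[ℂ] H} {V : Submodule ℂ H} [FiniteDimensional ℂ V]
    (h : ∀ x, F x ∈ V) : IsCompactOperator F := by
  have hc : IsCompactOperator (F.codRestrict V h) :=
    isCompactOperator_of_locallyCompactSpace_dom _
  exact hc.clm_comp V.subtypeL

/-- A self-adjoint operator whose nonzero spectrum consists of isolated points with finite
dimensional eigenspaces is compact. -/
theorem isCompactOperator_of_isolated_spectrum [CompleteSpace H] {T : H →L[ℂ] H}
    (hT : IsSelfAdjoint T)
    (hiso : ∀ l ∈ spectrum ℝ T, l ≠ 0 → ∃ ε > 0, ∀ m ∈ spectrum ℝ T, dist m l < ε → m = l)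
    (hfin : ∀ l ∈ spectrum ℝ T, l ≠ 0 →
      FiniteDimensional ℂ (LinearMap.ker (T - (l : ℂ) • (1 : H →L[ℂ] H)).toLinearMap)) :
    IsCompactOperator T := by
  -- Every function is continuous at an isolated point of the spectrum. So only continuity at 0 can
  -- fail, and functions vanishing near 0 are admissible in the functional calculus.
  have hcont : ∀ (f : ℝ → ℝ) (l : ℝ), l ∈ spectrum ℝ T → l ≠ 0 →
      ContinuousWithinAt f (spectrum ℝ T) l := by
    intro f l hl hl0
    obtain ⟨ε, hε, h⟩ := hiso l hl hl0
    refine (continuousWithinAt_const (b := f l)).congr_of_eventuallyEq ?_ rfl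
    filter_upwards [inter_mem_nhdsWithin _ (Metric.ball_mem_nhds l hε)] with m hm
    exact congrArg f (h m hm.1 hm.2)
  have hcont0 : ∀ (f : ℝ → ℝ) (ε : ℝ), 0 < ε → (∀ t, |t| < ε → f t = 0) →
      ContinuousOn f (spectrum ℝ T) := by
    intro f ε hε hf l hl
    by_cases hl0 : l = 0
    · subst hl0
      refine ContinuousAt.continuousWithinAt ?_
      refine (continuousAt_const (y := (0 : ℝ))).congr ?_
      filter_upwards [Metric.ball_mem_nhds (0 : ℝ) hε] with t ht
      rw [hf t (by simpa using ht)]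
    · exact hcont f l hl hl0
  have happrox : ∀ ε > 0, ∃ F : H →L[ℂ] H, IsCompactOperator F ∧ ‖T - F‖ ≤ ε := by
    intro ε hε
    let f : ℝ → ℝ := fun t => if ε ≤ |t| then t else 0
    have hf : ContinuousOn f (spectrum ℝ T) :=
      hcont0 f ε hε fun t ht => by simp [f, not_le.2 ht]
    refine ⟨cfc f T, ?_, ?_⟩
    · have hS : IsCompact (spectrum ℝ T ∩ {t | ε ≤ |t|}) :=
        (spectrum.isCompact T).inter_right (isClosed_le continuous_const continuous_abs)
      -- A compact set all of whose points are isolated is finite.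
      have hSfin : (spectrum ℝ T ∩ {t | ε ≤ |t|}).Finite := by
        refine hS.finite ?_
        rw [isDiscrete_iff_nhdsWithin]
        rintro l ⟨hl, hl'⟩
        have hl0 : l ≠ 0 := by
          rintro rfl
          simp at hl'
          linarith
        obtain ⟨δ, hδ, h⟩ := hiso l hl hl0
        refine le_antisymm ?_ (pure_le_nhdsWithin ⟨hl, hl'⟩)
        rw [Filter.le_pure_iff]
        filter_upwards [inter_mem_nhdsWithin _ (Metric.ball_mem_nhds l hδ)] with m hm
        exact h m hm.1.1 hm.2
      have hproj : ∀ l ∈ hSfin.toFinset,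
          IsCompactOperator
            (cfc (fun t : ℝ => if t = l then l else 0) T : H →L[ℂ] H) := by
        intro l hl
        obtain ⟨hl1, hl2⟩ := hSfin.mem_toFinset.1 hl
        have hl2' : ε ≤ |l| := hl2
        have hl0 : l ≠ 0 := by
          rintro rfl
          simp at hl2'
          linarith
        have := hfin l hl1 hl0
        refine isCompactOperator_of_range_le
          (V := LinearMap.ker (T - (l : ℂ) • (1 : H →L[ℂ] H)).toLinearMap) fun x => ?_
        -- `t - l` times a function supported at `l` is zero, so the range lies in the eigenspace of
        -- `l`, which has finite dimension.
        have hz : (T - (l : ℂ) • (1 : H →L[ℂ] H)) * cfc (fun t : ℝ => if t = l then l else 0) T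
            = 0 := by
          have h1 : T - (l : ℂ) • (1 : H →L[ℂ] H) = cfc (fun t : ℝ => t - l) T := by
            rw [cfc_sub (fun t : ℝ => t) (fun _ => l) T, cfc_id' ℝ T hT, cfc_const l T hT,
              Algebra.algebraMap_eq_smul_one]
            rfl
          rw [h1, ← cfc_mul (fun t : ℝ => t - l) _ T (by fun_prop)
            (hcont0 _ ε hε fun t ht => if_neg (by rintro rfl; linarith))]
          rw [← cfc_const_zero ℝ T]
          congr 1
          funext t
          split_ifs with h
          · simp [h]
          · simp
        exact DFunLike.congr_fun hz x
      have hsum : cfc f T = ∑ l ∈ hSfin.toFinset, cfc (fun t : ℝ => if t = l then l else 0) T := by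
        rw [← cfc_sum (fun l t : ℝ => if t = l then l else 0) T hSfin.toFinset fun l hl => by
          have hl2' : ε ≤ |l| := (hSfin.mem_toFinset.1 hl).2
          exact hcont0 _ ε hε fun t ht => if_neg (by rintro rfl; linarith)]
        refine cfc_congr fun t ht => ?_
        simp only [Finset.sum_apply, Finset.sum_ite_eq, Set.Finite.mem_toFinset, f]
        simp [ht]
      rw [hsum]
      refine Finset.sum_induction _ (fun F : H →L[ℂ] H => IsCompactOperator F)
        (fun F G hF hG => hF.add hG) isCompactOperator_zero hproj
    · nth_rw 1 [← cfc_id' ℝ T hT]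
      rw [← cfc_sub (fun t : ℝ => t) f T (by fun_prop) hf]
      refine norm_cfc_le hε.le fun t _ => ?_
      simp only [f]
      split_ifs with h
      · simpa using hε.le
      · simpa using (not_le.1 h).le
  have hclosed := isClosed_setOfPred_isCompactOperator (σ₁₂ := RingHom.id ℂ) (M₁ := H) (M₂ := H)
  refine hclosed.closure_subset (a := T) (Metric.mem_closure_iff.2 fun ε hε => ?_)
  obtain ⟨F, hF, hF'⟩ := happrox (ε / 2) (by positivity)
  refine ⟨F, hF, ?_⟩
  rw [dist_eq_norm]
  linarith

/-- The map `l ↦ l⁻¹ - 1` is continuous and injective off 0 and sends the nonzero spectrum of `T`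
into that of `A`; isolation and finite multiplicity pull back along it. -/
theorem IsResolventAtNegOne.isCompactOperator [CompleteSpace H] {A : H →ₗ.[ℂ] H} {T : H →L[ℂ] H}
    (h : IsResolventAtNegOne A T) (hT : IsSelfAdjoint T) (hA : essentialSpectrum A = ∅) :
    IsCompactOperator T := by
  have hdisc : ∀ l ∈ spectrum ℝ T, l ≠ 0 → ((l : ℂ)⁻¹ - 1) ∈ discreteSpectrum A := by
    intro l hl hl0
    have h1 : (l : ℂ) ∈ spectrum ℂ T := (spectrum.algebraMap_mem_iff ℂ).2 hl
    have h2 := h.mem_spectrumOp (by exact_mod_cast hl0) h1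
    by_contra h3
    have h4 : ((l : ℂ)⁻¹ - 1) ∈ essentialSpectrum A := ⟨h2, h3⟩
    simp [hA] at h4
  refine isCompactOperator_of_isolated_spectrum hT (fun l hl hl0 => ?_) fun l hl hl0 => ?_
  · obtain ⟨-, ⟨ε, hε, hiso⟩, -⟩ := hdisc l hl hl0
    have hc : ContinuousAt (fun m : ℝ => (m : ℂ)⁻¹ - 1) l :=
      (Complex.continuous_ofReal.continuousAt.inv₀ (by exact_mod_cast hl0)).sub continuousAt_const
    have hev : ∀ᶠ m : ℝ in nhds l, dist ((m : ℂ)⁻¹ - 1) ((l : ℂ)⁻¹ - 1) < ε ∧ m ≠ 0 :=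
      (hc.eventually (Metric.ball_mem_nhds _ hε)).and
        (continuousAt_id.eventually_ne hl0)
    obtain ⟨δ, hδ, hball⟩ := Metric.eventually_nhds_iff.1 hev
    refine ⟨δ, hδ, fun m hm hml => ?_⟩
    obtain ⟨h1, h2⟩ := hball hml
    have h3 := hiso _ (hdisc m hm h2).1 h1
    have h4 : (m : ℂ)⁻¹ = (l : ℂ)⁻¹ := sub_left_injective h3
    exact_mod_cast inv_injective h4
  · exact h.finiteDimensional_ker (by exact_mod_cast hl0) (hdisc l hl hl0).2.2.2

/-- The quadratic form of a compact operator is not bounded below on an orthonormal sequence. -/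
theorem not_isCompactOperator_of_orthonormal {T : H →L[ℂ] H} {e : ℕ → H} (he : Orthonormal ℂ e)
    {c : ℝ} (hc : 0 < c) (hTe : ∀ k, c ≤ ‖inner ℂ (e k) (T (e k))‖) : ¬ IsCompactOperator T := by
  intro hT
  have hK := hT.isCompact_closure_image_closedBall (f := (T : H →ₗ[ℂ] H)) 1
  obtain ⟨w, -, φ, hφ, hw⟩ := hK.tendsto_subseq (x := fun k => T (e k)) fun k =>
    subset_closure ⟨e k, by simp [he.1 k], rfl⟩
  -- Bessel's inequality: an orthonormal sequence tends weakly to 0, so its pairings with the limit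
  -- `w` vanish asymptotically.
  have h1 : Filter.Tendsto (fun k => ‖inner ℂ (e (φ k)) w‖ ^ 2) Filter.atTop (nhds 0) :=
    (he.inner_products_summable w).tendsto_atTop_zero.comp hφ.tendsto_atTop
  have h2 : Filter.Tendsto (fun k => ‖T (e (φ k)) - w‖) Filter.atTop (nhds 0) :=
    tendsto_iff_norm_sub_tendsto_zero.1 hw
  have h3 : ∀ᶠ k in Filter.atTop, ‖inner ℂ (e (φ k)) w‖ ^ 2 < (c / 2) ^ 2 :=
    h1.eventually_lt_const (by positivity)
  have h4 : ∀ᶠ k in Filter.atTop, ‖T (e (φ k)) - w‖ < c / 2 :=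
    h2.eventually_lt_const (by positivity)
  obtain ⟨k, hk3, hk4⟩ := (h3.and h4).exists
  have h5 := lt_of_pow_lt_pow_left₀ 2 (by positivity) hk3
  have h6 : inner ℂ (e (φ k)) (T (e (φ k))) =
      inner ℂ (e (φ k)) (T (e (φ k)) - w) + inner ℂ (e (φ k)) w := by
    rw [← inner_add_right, sub_add_cancel]
  have h7 := norm_inner_le_norm (𝕜 := ℂ) (e (φ k)) (T (e (φ k)) - w)
  rw [he.1, one_mul] at h7
  have h8 := hTe (φ k)
  rw [h6] at h8
  linarith [norm_add_le (inner ℂ (e (φ k)) (T (e (φ k)) - w)) (inner ℂ (e (φ k)) w)]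

end Compact

/-! ### The geometry of the rooms-and-passages domain -/

section Geometry

variable {d dh β : ℕ → ℝ}

theorem abscissa_succ (k : ℕ) : abscissa d dh (k + 1) = abscissa d dh k + dh k + d (k + 1) := by
  simp only [abscissa, Finset.sum_range_succ _ (k + 1)]
  ring

theorem abscissa_sub_eq_sum (k : ℕ) :
    abscissa d dh k - d k = ∑ j ∈ Finset.range k, (d j + dh j) := by
  simp only [abscissa, Finset.sum_range_succ]
  ring

theorem abscissa_add_le (hd : ∀ k, 0 < d k) (hdh : ∀ k, 0 < dh k) {j k : ℕ} (hjk : j < k) :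
    abscissa d dh j + dh j ≤ abscissa d dh k - d k := by
  rw [abscissa_sub_eq_sum]
  have h1 : abscissa d dh j + dh j = ∑ i ∈ Finset.range (j + 1), (d i + dh i) := by
    simp [abscissa]
  rw [h1]
  exact Finset.sum_le_sum_of_subset_of_nonneg (Finset.range_subset_range.2 hjk)
    fun i _ _ => (add_pos (hd i) (hdh i)).le

/-- Over the closed interval of abscissas of a passage the domain contains nothing else. This later
confines the gradients to thin sets. -/
theorem mem_passage_of_mem_domain (hd : ∀ k, 0 < d k) (hdh : ∀ k, 0 < dh k) {k : ℕ}
    {z : ℝ × ℝ} (hz : z ∈ domain d dh β) (h1 : abscissa d dh k ≤ z.1)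
    (h2 : z.1 ≤ abscissa d dh k + dh k) : z ∈ passage d dh β k := by
  obtain ⟨j, hj⟩ := Set.mem_iUnion.1 hz
  have hroom : z ∉ room d dh j := by
    rintro ⟨⟨h3, h4⟩, -⟩
    rcases lt_or_ge k j with h | h
    · linarith [abscissa_add_le hd hdh h]
    · rcases h.lt_or_eq with h | h
      · linarith [abscissa_add_le hd hdh h, hd k, hdh j]
      · subst h
        linarith
  rcases hj with hj | hj
  · exact absurd hj hroom
  · rcases lt_trichotomy k j with h | h | h
    · obtain ⟨⟨h3, -⟩, -⟩ := hj
      linarith [abscissa_add_le hd hdh h, hd j]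
    · exact h ▸ hj
    · obtain ⟨⟨-, h3⟩, -⟩ := hj
      linarith [abscissa_add_le hd hdh h, hd k]

/-- The passage with index `k`, prolonged into the two adjacent rooms. -/
def strip (d dh β : ℕ → ℝ) (k : ℕ) : Set (ℝ × ℝ) :=
  Set.Ioo (abscissa d dh k - d k) (abscissa d dh (k + 1)) ×ˢ Set.Ioo (-(β k / 2)) (β k / 2)

/-- A passage is closed at its ends. As it is no wider than its rooms, prolonging it into them adds
no point and makes every piece of the union open. -/
theorem domain_eq_iUnion_strip (hd : ∀ k, 0 < d k)
    (hβd : ∀ k, β k ≤ d k) (hβd' : ∀ k, β k ≤ d (k + 1)) :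
    domain d dh β = ⋃ k, (room d dh k ∪ strip d dh β k) := by
  refine Set.Subset.antisymm (Set.iUnion_mono fun k => Set.union_subset_union_right _ ?_)
    (Set.iUnion_subset fun k => Set.union_subset ?_ ?_)
  · rintro z ⟨⟨h1, h2⟩, h3⟩
    refine ⟨⟨?_, ?_⟩, h3⟩
    · linarith [hd k]
    · rw [abscissa_succ]
      linarith [hd (k + 1)]
  · exact fun z hz => Set.mem_iUnion.2 ⟨k, Or.inl hz⟩
  · rintro z ⟨⟨h1, h2⟩, h3, h4⟩
    rcases lt_or_ge z.1 (abscissa d dh k) with h | h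
    · exact Set.mem_iUnion.2 ⟨k, Or.inl ⟨⟨h1, h⟩, by linarith [hβd k], by linarith [hβd k]⟩⟩
    rcases le_or_gt z.1 (abscissa d dh k + dh k) with h' | h'
    · exact Set.mem_iUnion.2 ⟨k, Or.inr ⟨⟨h, h'⟩, h3, h4⟩⟩
    · refine Set.mem_iUnion.2 ⟨k + 1, Or.inl ⟨⟨?_, h2⟩, ?_, ?_⟩⟩
      · rw [abscissa_succ]
        linarith
      · linarith [hβd' k]
      · linarith [hβd' k]

theorem isOpen_domain (hd : ∀ k, 0 < d k)
    (hβd : ∀ k, β k ≤ d k) (hβd' : ∀ k, β k ≤ d (k + 1)) : IsOpen (domain d dh β) := by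
  rw [domain_eq_iUnion_strip hd hβd hβd']
  exact isOpen_iUnion fun k => (isOpen_Ioo.prod isOpen_Ioo).union (isOpen_Ioo.prod isOpen_Ioo)

theorem isConnected_domain (hd : ∀ k, 0 < d k) (hdh : ∀ k, 0 < dh k) (hβ : ∀ k, 0 < β k)
    (hβd : ∀ k, β k ≤ d k) (hβd' : ∀ k, β k ≤ d (k + 1)) : IsConnected (domain d dh β) := by
  rw [domain_eq_iUnion_strip hd hβd hβd']
  have hmid : ∀ k, (abscissa d dh k - d k / 2, (0 : ℝ)) ∈ room d dh k := fun k =>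
    ⟨⟨by simp only; linarith [hd k], by simp only; linarith [hd k]⟩,
      by simp only; linarith [hd k], by simp only; linarith [hd k]⟩
  have hlt : ∀ k, abscissa d dh k - d k < abscissa d dh (k + 1) := fun k => by
    rw [abscissa_succ]
    linarith [hd k, hdh k, hd (k + 1)]
  have hstrip : ∀ k x, x ∈ Set.Ioo (abscissa d dh k - d k) (abscissa d dh (k + 1)) →
      (x, (0 : ℝ)) ∈ strip d dh β k := fun k x hx =>
    ⟨hx, by simp only; linarith [hβ k], by simp only; linarith [hβ k]⟩
  refine IsConnected.iUnion_of_chain (fun k => ?_) fun k => ?_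
  · refine IsConnected.union ⟨_, hmid k, hstrip k _ ⟨by linarith [hd k], ?_⟩⟩
      ⟨⟨_, hmid k⟩, ((convex_Ioo _ _).prod (convex_Ioo _ _)).isPreconnected⟩
      ⟨⟨_, hstrip k _ (Set.nonempty_Ioo.2 (hlt k)).some_mem⟩,
        ((convex_Ioo _ _).prod (convex_Ioo _ _)).isPreconnected⟩
    rw [abscissa_succ]
    linarith [hd k, hdh k, hd (k + 1)]
  -- Strip `k` reaches the centre of room `k + 1`, which links consecutive pieces.
  · refine ⟨_, Or.inr (hstrip k _ ⟨?_, ?_⟩), Or.inl (hmid (k + 1))⟩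
    · rw [abscissa_succ]
      linarith [hd k, hdh k, hd (k + 1)]
    · linarith [hd (k + 1)]

theorem isBounded_domain (hd : ∀ k, 0 < d k) (hdh : ∀ k, 0 < dh k)
    (hβd : ∀ k, β k ≤ d k) (hsum : Summable d) (hsum' : Summable dh) :
    Bornology.IsBounded (domain d dh β) := by
  have hs := hsum.add hsum'
  have hnn : ∀ j, 0 ≤ d j + dh j := fun j => (add_pos (hd j) (hdh j)).le
  have hL : ∀ k, abscissa d dh k + dh k ≤ ∑' j, (d j + dh j) := fun k => by
    rw [abscissa, sub_add_cancel]
    exact hs.sum_le_tsum _ fun j _ => hnn j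
  have h0 : ∀ k, 0 ≤ abscissa d dh k - d k := fun k => by
    rw [abscissa_sub_eq_sum]
    exact Finset.sum_nonneg fun j _ => hnn j
  refine ((Metric.isBounded_Icc 0 (∑' j, (d j + dh j))).prod (Metric.isBounded_Icc
    (-∑' j, (d j + dh j)) (∑' j, (d j + dh j)))).subset (Set.iUnion_subset fun k => ?_)
  have := hL k
  have := h0 k
  have := hd k
  have := hdh k
  have := hβd k
  rintro z (⟨⟨h1, h2⟩, h3, h4⟩ | ⟨⟨h1, h2⟩, h3, h4⟩) <;>
    exact ⟨⟨by linarith, by linarith⟩, by linarith, by linarith⟩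

theorem volume_passage (hdh : 0 ≤ dh k) (hβ : 0 ≤ β k) :
    volume.real (passage d dh β k) = dh k * β k := by
  rw [passage, Measure.real, Measure.volume_eq_prod, Measure.prod_prod, Real.volume_Icc,
    Real.volume_Ioo, ← ENNReal.ofReal_mul (by linarith), ENNReal.toReal_ofReal]
  · ring
  · exact mul_nonneg (by linarith) (by linarith)

theorem volume_room (k : ℕ) (hd : 0 ≤ d k) : volume.real (room d dh k) = d k ^ 2 := by
  rw [room, Measure.real, Measure.volume_eq_prod, Measure.prod_prod, Real.volume_Ioo,
    Real.volume_Ioo, ← ENNReal.ofReal_mul (by linarith), ENNReal.toReal_ofReal]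
  · ring
  · exact mul_nonneg (by linarith) (by linarith)

theorem bddAbove_range_of_summable {f : ℕ → ℝ} (hf : Summable f) : BddAbove (Set.range f) :=
  hf.tendsto_atTop_zero.bddAbove_range

/-- The exponent `1 - α` is negative, so the power of the supremum is at most `dh k ^ (1 - α)`,
which cancels all but one factor of `dh k ^ α`. -/
theorem width_le_length_div (C₁ C₂ α : ℝ) (hdh : ∀ k, 0 < dh k) (hsum' : Summable dh)
    (hC₁ : 0 < C₁) (hα : 3 ≤ α) (hβC : ∀ k, β k ≤ C₂ * dh k ^ α)
    (hC₂max : C₂ ≤ 1 / C₁ * (⨆ k, dh k) ^ (1 - α)) (k : ℕ) : β k ≤ dh k / C₁ := by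
  have hM : dh k ≤ ⨆ k, dh k := le_ciSup (bddAbove_range_of_summable hsum') k
  have hk := hdh k
  have hM0 : 0 < ⨆ k, dh k := hk.trans_le hM
  calc β k ≤ C₂ * dh k ^ α := hβC k
    _ ≤ 1 / C₁ * (⨆ k, dh k) ^ (1 - α) * dh k ^ α := by gcongr
    _ ≤ 1 / C₁ * dh k ^ (1 - α) * dh k ^ α := by
        gcongr ?_ * ?_ * ?_
        exact Real.rpow_le_rpow_of_nonpos hk hM (by linarith)
    _ = dh k / C₁ := by
        rw [mul_assoc, ← Real.rpow_add hk, sub_add_cancel, Real.rpow_one]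
        ring

/-- Boundedness of `dh` absorbs the surplus exponent `α - 3`. The cube is what the energy estimate
needs: it makes `β / dh` of order `dh ^ 2`. -/
theorem exists_width_le_mul_cube (C₂ α : ℝ) (hdh : ∀ k, 0 < dh k) (hsum' : Summable dh)
    (hα : 3 ≤ α) (hC₂ : 0 < C₂) (hβC : ∀ k, β k ≤ C₂ * dh k ^ α) :
    ∃ C, 0 < C ∧ ∀ k, β k ≤ C * dh k ^ 3 := by
  have hM : ∀ k, dh k ≤ ⨆ k, dh k := le_ciSup (bddAbove_range_of_summable hsum')
  have hM0 : 0 < ⨆ k, dh k := (hdh 0).trans_le (hM 0)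
  refine ⟨C₂ * (⨆ k, dh k) ^ (α - 3), by positivity, fun k => ?_⟩
  have hk := hdh k
  calc β k ≤ C₂ * dh k ^ α := hβC k
    _ = C₂ * (dh k ^ (α - 3) * dh k ^ 3) := by
        rw [← Real.rpow_add_natCast hk.ne']
        norm_num
    _ ≤ C₂ * ((⨆ k, dh k) ^ (α - 3) * dh k ^ 3) := by
        gcongr ?_ * (?_ * ?_)
        exact Real.rpow_le_rpow hk.le (hM k) (by linarith)
    _ = _ := by ring

end Geometry

/-! ### The resolvent of the Neumann Laplacian -/

section NeumannResolvent

variable {Ω : Set (ℝ × ℝ)}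

/-- The integral is an inner product with a fixed element of `L²`. Hence the weak derivative
relation is closed and `H¹` is complete, as the adjoint of the embedding requires. -/
theorem continuous_setIntegral_smul {ψ : ℝ × ℝ → ℝ} (hc : Continuous ψ) (hs : HasCompactSupport ψ) :
    Continuous fun u : L2 Ω => ∫ z in Ω, ψ z • u z := by
  have h : (fun u : L2 Ω => ∫ z in Ω, ψ z • u z) =
      fun u => inner ℂ (memLp_ofReal (Ω := Ω) hc hs).toLp u := by
    funext u
    rw [L2.inner_def]
    refine integral_congr_ae ?_
    filter_upwards [MemLp.coeFn_toLp (memLp_ofReal (Ω := Ω) hc hs)] with z hz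
    simp [hz, mul_comm]
  rw [h]
  fun_prop

theorem isClosed_setOf_hasWeakPartial (e : ℝ × ℝ) (i j : Fin 3) :
    IsClosed {U : PiLp 2 fun _ : Fin 3 => L2 Ω | HasWeakPartial Ω e (U i) (U j)} := by
  simp only [HasWeakPartial, Set.ofPred_forall]
  refine isClosed_iInter fun φ => isClosed_iInter fun hφ => isClosed_eq ?_ (Continuous.neg ?_)
  · exact (continuous_setIntegral_smul (hφ.continuous_fderiv_apply e)
      (hφ.hasCompactSupport_fderiv_apply e)).comp (PiLp.continuous_apply 2 _ i)
  · exact (continuous_setIntegral_smul hφ.contDiff.continuous hφ.hasCompactSupport).comp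
      (PiLp.continuous_apply 2 _ j)

instance completeSpace_H1 : CompleteSpace (H1 Ω) :=
  ((isClosed_setOf_hasWeakPartial (1, 0) 0 1).inter
    (isClosed_setOf_hasWeakPartial (0, 1) 0 2)).completeSpace_coe

theorem inner_H1 (U V : H1 Ω) :
    inner ℂ V U = neumannForm Ω U V + inner ℂ (embedding Ω V) (embedding Ω U) := by
  change inner ℂ V.1 U.1 = _ + inner ℂ (V.1 0) (U.1 0)
  rw [PiLp.inner_apply, Fin.sum_univ_three, neumannForm]
  ring

/-- The resolvent `(A_Ω + 1)⁻¹ = J J*`, where `J` is the embedding of `H¹(Ω)` into `L²(Ω)`. -/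
noncomputable def neumannResolvent (Ω : Set (ℝ × ℝ)) : L2 Ω →L[ℂ] L2 Ω :=
  embedding Ω ∘L (embedding Ω).adjoint

theorem isSelfAdjoint_neumannResolvent : IsSelfAdjoint (neumannResolvent Ω) := by
  rw [IsSelfAdjoint, ContinuousLinearMap.star_eq_adjoint, neumannResolvent,
    ContinuousLinearMap.adjoint_comp, ContinuousLinearMap.adjoint_adjoint]

theorem inner_neumannResolvent (f : L2 Ω) :
    inner ℂ f (neumannResolvent Ω f) = (‖(embedding Ω).adjoint f‖ : ℂ) ^ 2 := by
  have h := inner_self_eq_norm_sq_to_K (𝕜 := ℂ) ((embedding Ω).adjoint f)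
  rw [ContinuousLinearMap.adjoint_inner_left] at h
  exact h

/-- Adding `(u, v)` to both sides of the weak equation turns it into `⟨V, U⟩ = ⟨J V, g + u⟩` with
the `H¹` inner product on the left, that is, `U = J* (g + u)`. -/
theorem isResolventAtNegOne_neumann (hΩ : IsOpen Ω) :
    IsResolventAtNegOne (neumannLaplacian Ω) (neumannResolvent Ω) := by
  intro u g
  rw [neumannLaplacian_graph hΩ]
  constructor
  · rintro ⟨U, rfl, hU⟩
    have : (embedding Ω).adjoint (g + embedding Ω U) = U := by
      refine ext_inner_left ℂ fun V => ?_
      rw [ContinuousLinearMap.adjoint_inner_right, inner_add_right, inner_H1]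
      rw [← hU V]
    exact congrArg (embedding Ω) this
  · intro h
    refine ⟨(embedding Ω).adjoint (g + u), h, fun V => ?_⟩
    have h1 := inner_H1 ((embedding Ω).adjoint (g + u)) V
    have h2 : embedding Ω ((embedding Ω).adjoint (g + u)) = u := h
    rw [ContinuousLinearMap.adjoint_inner_right, inner_add_right, h2] at h1
    exact add_right_cancel h1

theorem neumannResolvent_injective (hΩ : IsOpen Ω) :
    Function.Injective (neumannResolvent Ω) := by
  rw [injective_iff_map_eq_zero]
  intro f hf
  have h0 : (0, f) ∈ (neumannLaplacian Ω).graph := by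
    rw [isResolventAtNegOne_neumann hΩ, add_zero, hf]
  exact (neumannLaplacian Ω).graph_fst_eq_zero_snd h0 rfl

theorem isSelfAdjoint_neumannLaplacian (hΩ : IsOpen Ω) : IsSelfAdjoint (neumannLaplacian Ω) :=
  (isResolventAtNegOne_neumann hΩ).isSelfAdjoint isSelfAdjoint_neumannResolvent
    (neumannResolvent_injective hΩ)

/-- With `e = J U` of norm 1, `1 = ⟨U, J* e⟩ ≤ C ‖J* e‖`, so `⟨e, J J* e⟩ = ‖J* e‖²` is at least `1
/ C²` along the whole sequence. -/
theorem not_isCompactOperator_neumannResolvent {U : ℕ → H1 Ω} {C : ℝ}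
    (hU : Orthonormal ℂ fun k => embedding Ω (U k)) (hC : ∀ k, ‖U k‖ ≤ C) :
    ¬ IsCompactOperator (neumannResolvent Ω) := by
  have hlow : ∀ k, 1 ≤ C * ‖(embedding Ω).adjoint (embedding Ω (U k))‖ := by
    intro k
    have h1 : inner ℂ (U k) ((embedding Ω).adjoint (embedding Ω (U k))) = 1 := by
      rw [ContinuousLinearMap.adjoint_inner_right, inner_self_eq_norm_sq_to_K, hU.1 k]
      simp
    have h2 := norm_inner_le_norm (𝕜 := ℂ) (U k) ((embedding Ω).adjoint (embedding Ω (U k)))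
    rw [h1, norm_one] at h2
    exact h2.trans (mul_le_mul_of_nonneg_right (hC k) (norm_nonneg _))
  have hC0 : 0 < C := by
    by_contra h
    have := hlow 0
    nlinarith [norm_nonneg ((embedding Ω).adjoint (embedding Ω (U 0)))]
  refine not_isCompactOperator_of_orthonormal hU (c := (1 / C) ^ 2) (by positivity) fun k => ?_
  rw [inner_neumannResolvent, norm_pow, Complex.norm_real, norm_norm]
  gcongr
  rw [div_le_iff₀ hC0, mul_comm]
  exact hlow k

theorem not_isCompactOperator_embedding {U : ℕ → H1 Ω} {C : ℝ}
    (hU : Orthonormal ℂ fun k => embedding Ω (U k)) (hC : ∀ k, ‖U k‖ ≤ C) :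
    ¬ IsCompactOperator (embedding Ω) := fun h =>
  not_isCompactOperator_neumannResolvent hU hC (h.comp_clm (embedding Ω).adjoint)

theorem essentialSpectrum_neumannLaplacian_nonempty (hΩ : IsOpen Ω) {U : ℕ → H1 Ω} {C : ℝ}
    (hU : Orthonormal ℂ fun k => embedding Ω (U k)) (hC : ∀ k, ‖U k‖ ≤ C) :
    (essentialSpectrum (neumannLaplacian Ω)).Nonempty := by
  by_contra h
  exact not_isCompactOperator_neumannResolvent hU hC
    ((isResolventAtNegOne_neumann hΩ).isCompactOperator isSelfAdjoint_neumannResolvent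
      (Set.not_nonempty_iff_eq_empty.1 h))

/-- Nonzero functions in `H¹(Ω)` that are pairwise orthogonal in `L²(Ω)` and have uniformly bounded
Rayleigh quotients can be normalised. -/
theorem exists_orthonormal_of_rayleigh_le {U : ℕ → H1 Ω} {C : ℝ}
    (h0 : ∀ k, embedding Ω (U k) ≠ 0)
    (horth : Pairwise fun j k => inner ℂ (embedding Ω (U j)) (embedding Ω (U k)) = 0)
    (hC : ∀ k, ‖U k‖ ≤ C * ‖embedding Ω (U k)‖) :
    ∃ V : ℕ → H1 Ω, (Orthonormal ℂ fun k => embedding Ω (V k)) ∧ ∀ k, ‖V k‖ ≤ C := by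
  refine ⟨fun k => ((‖embedding Ω (U k)‖⁻¹ : ℝ) : ℂ) • U k, ⟨fun k => ?_, fun j k hjk => ?_⟩,
    fun k => ?_⟩
  · beta_reduce
    rw [map_smul, norm_smul, Complex.norm_real, norm_inv, norm_norm,
      inv_mul_cancel₀ (norm_ne_zero_iff.2 (h0 k))]
  · simp only [map_smul, inner_smul_left, inner_smul_right, horth hjk, mul_zero]
  · rw [norm_smul, Complex.norm_real, norm_inv, norm_norm,
      inv_mul_le_iff₀ (norm_pos_iff.2 (h0 k)), mul_comm]
    exact hC k

end NeumannResolvent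

/-! ### Test functions concentrated on a single room -/

section Plateau

/-- The indicator keeps track of where the derivative lives, so that after rescaling it is carried
by the passages. -/
theorem exists_abs_deriv_smoothTransition_le :
    ∃ M, ∀ t, |deriv Real.smoothTransition t| ≤
      (Set.Icc (0 : ℝ) 1).indicator (fun _ => M) t := by
  have hc : Continuous (deriv Real.smoothTransition) :=
    (Real.smoothTransition.contDiff (n := 1)).continuous_deriv (by simp)
  obtain ⟨M, hM⟩ := (isCompact_Icc (a := (0 : ℝ)) (b := 1)).exists_bound_of_continuousOn
    hc.continuousOn
  refine ⟨M, fun t => ?_⟩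
  by_cases ht : t ∈ Set.Icc (0 : ℝ) 1
  · rw [Set.indicator_of_mem ht]
    exact hM t ht
  · rw [Set.indicator_of_notMem ht, abs_nonpos_iff]
    rw [Set.mem_Icc, not_and_or, not_le, not_le] at ht
    rcases ht with ht | ht
    · have : Real.smoothTransition =ᶠ[nhds t] fun _ => 0 := by
        filter_upwards [eventually_lt_nhds ht] with s hs
        exact Real.smoothTransition.zero_of_nonpos hs.le
      rw [this.deriv_eq, deriv_const]
    · have : Real.smoothTransition =ᶠ[nhds t] fun _ => 1 := by
        filter_upwards [eventually_gt_nhds ht] with s hs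
        exact Real.smoothTransition.one_of_one_le hs.le
      rw [this.deriv_eq, deriv_const]

/-- A smooth function supported in `[a, b]`, equal to `1` on `[a + δ, b - ε]`. -/
noncomputable def plateau (a b δ ε x : ℝ) : ℝ :=
  Real.smoothTransition ((x - a) / δ) * Real.smoothTransition ((b - x) / ε)

variable {a b δ ε x : ℝ}

theorem contDiff_plateau : ContDiff ℝ ∞ (plateau a b δ ε) :=
  (Real.smoothTransition.contDiff.comp ((contDiff_id.sub contDiff_const).div_const δ)).mul
    (Real.smoothTransition.contDiff.comp ((contDiff_const.sub contDiff_id).div_const ε))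

theorem plateau_nonneg : 0 ≤ plateau a b δ ε x :=
  mul_nonneg (Real.smoothTransition.nonneg _) (Real.smoothTransition.nonneg _)

theorem plateau_le_one : plateau a b δ ε x ≤ 1 :=
  mul_le_one₀ (Real.smoothTransition.le_one _) (Real.smoothTransition.nonneg _)
    (Real.smoothTransition.le_one _)

theorem plateau_eq_one (hδ : 0 < δ) (hε : 0 < ε) (h1 : a + δ ≤ x) (h2 : x ≤ b - ε) :
    plateau a b δ ε x = 1 := by
  rw [plateau, Real.smoothTransition.one_of_one_le, Real.smoothTransition.one_of_one_le, one_mul]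
  · rw [one_le_div hε]
    linarith
  · rw [one_le_div hδ]
    linarith

theorem plateau_eq_zero_of_le (hδ : 0 < δ) (h : x ≤ a) : plateau a b δ ε x = 0 := by
  rw [plateau, Real.smoothTransition.zero_of_nonpos, zero_mul]
  exact div_nonpos_of_nonpos_of_nonneg (by linarith) hδ.le

theorem plateau_eq_zero_of_ge (hε : 0 < ε) (h : b ≤ x) : plateau a b δ ε x = 0 := by
  rw [plateau, Real.smoothTransition.zero_of_nonpos (x := (b - x) / ε), mul_zero]
  exact div_nonpos_of_nonpos_of_nonneg (by linarith) hε.le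

theorem hasDerivAt_plateau : HasDerivAt (plateau a b δ ε)
    (deriv Real.smoothTransition ((x - a) / δ) * (1 / δ) * Real.smoothTransition ((b - x) / ε) +
      Real.smoothTransition ((x - a) / δ) * (deriv Real.smoothTransition ((b - x) / ε) * (-1 / ε)))
    x := by
  have hd : Differentiable ℝ Real.smoothTransition :=
    (Real.smoothTransition.contDiff (n := 1)).differentiable (by simp)
  have h1 : HasDerivAt (fun x => (x - a) / δ) (1 / δ) x :=
    ((hasDerivAt_id x).sub_const a).div_const δ
  have h2 : HasDerivAt (fun x => (b - x) / ε) (-1 / ε) x :=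
    ((hasDerivAt_id x).const_sub b).div_const ε
  exact ((hd _).hasDerivAt.comp x h1).mul ((hd _).hasDerivAt.comp x h2)

/-- In each term of the product rule the undifferentiated factor lies in `[0, 1]`. The factor 2
comes from `(p + q)² ≤ 2 (p² + q²)`, so the two transition intervals need not be disjoint. -/
theorem sq_deriv_plateau_le (hδ : 0 < δ) (hε : 0 < ε) {M : ℝ}
    (hM : ∀ t, |deriv Real.smoothTransition t| ≤ (Set.Icc (0 : ℝ) 1).indicator (fun _ => M) t) :
    deriv (plateau a b δ ε) x ^ 2 ≤
      (Set.Icc a (a + δ)).indicator (fun _ => 2 * (M / δ) ^ 2) x +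
      (Set.Icc (b - ε) b).indicator (fun _ => 2 * (M / ε) ^ 2) x := by
  have key : ∀ t s η : ℝ, 0 < η → 0 ≤ s → s ≤ 1 →
      (deriv Real.smoothTransition t * (1 / η) * s) ^ 2 ≤
        (Set.Icc (0 : ℝ) 1).indicator (fun _ => (M / η) ^ 2) t := by
    intro t s η hη hs0 hs1
    have h1 : (deriv Real.smoothTransition t * (1 / η) * s) ^ 2 ≤
        (deriv Real.smoothTransition t * (1 / η)) ^ 2 := by
      rw [mul_pow]
      exact mul_le_of_le_one_right (sq_nonneg _) (pow_le_one₀ hs0 hs1)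
    refine h1.trans ?_
    have h2 := hM t
    by_cases ht : t ∈ Set.Icc (0 : ℝ) 1
    · rw [Set.indicator_of_mem ht] at h2 ⊢
      rw [mul_one_div, div_pow, ← sq_abs (deriv _ _), ← div_pow]
      gcongr
    · rw [Set.indicator_of_notMem ht] at h2 ⊢
      rw [abs_nonpos_iff.1 h2]
      simp
  have h1 := key ((x - a) / δ) (Real.smoothTransition ((b - x) / ε)) δ hδ
    (Real.smoothTransition.nonneg _) (Real.smoothTransition.le_one _)
  have h2 := key ((b - x) / ε) (Real.smoothTransition ((x - a) / δ)) ε hε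
    (Real.smoothTransition.nonneg _) (Real.smoothTransition.le_one _)
  have e1 : (Set.Icc (0 : ℝ) 1).indicator (fun _ => (M / δ) ^ 2) ((x - a) / δ) =
      (Set.Icc a (a + δ)).indicator (fun _ => (M / δ) ^ 2) x := by
    have : (x - a) / δ ∈ Set.Icc (0 : ℝ) 1 ↔ x ∈ Set.Icc a (a + δ) := by
      rw [Set.mem_Icc, Set.mem_Icc, div_le_one hδ, le_div_iff₀ hδ]
      constructor <;> rintro ⟨h, h'⟩ <;> constructor <;> linarith
    simp only [Set.indicator, this]
  have e2 : (Set.Icc (0 : ℝ) 1).indicator (fun _ => (M / ε) ^ 2) ((b - x) / ε) =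
      (Set.Icc (b - ε) b).indicator (fun _ => (M / ε) ^ 2) x := by
    have : (b - x) / ε ∈ Set.Icc (0 : ℝ) 1 ↔ x ∈ Set.Icc (b - ε) b := by
      rw [Set.mem_Icc, Set.mem_Icc, div_le_one hε, le_div_iff₀ hε]
      constructor <;> rintro ⟨h, h'⟩ <;> constructor <;> linarith
    simp only [Set.indicator, this]
  rw [e1] at h1
  rw [e2] at h2
  have e3 : ∀ (s : Set ℝ) (c : ℝ), s.indicator (fun _ => 2 * c) x = 2 * s.indicator (fun _ => c) x :=
    fun s c => by by_cases h : x ∈ s <;> simp [h]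
  rw [hasDerivAt_plateau.deriv, e3, e3]
  refine (add_sq_le (a := _) (b := _)).trans ?_
  rw [mul_add]
  gcongr
  refine le_trans (le_of_eq ?_) h2
  ring

end Plateau

/-! ### Smooth functions on the plane as elements of `H¹(Ω)` -/

section SmoothFunctions

variable {Ω : Set (ℝ × ℝ)}

/-- The test function alone has compact support in `Ω`, which suffices to integrate by parts over
the whole plane; `w` need not vanish at the boundary. -/
theorem hasWeakPartial_of_contDiff {w : ℝ × ℝ → ℝ} (hw : ContDiff ℝ ∞ w) (e : ℝ × ℝ)
    (h1 : MemLp (fun z => (w z : ℂ)) 2 (volume.restrict Ω))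
    (h2 : MemLp (fun z => (fderiv ℝ w z e : ℂ)) 2 (volume.restrict Ω)) :
    HasWeakPartial Ω e h1.toLp h2.toLp := by
  intro ψ hψ
  rw [integral_congr_ae (g := fun z => ((fderiv ℝ ψ z e * w z : ℝ) : ℂ))
      (by filter_upwards [h1.coeFn_toLp] with z hz
          rw [hz]; simp),
    integral_congr_ae (f := fun z => ψ z • _) (g := fun z => ((ψ z * fderiv ℝ w z e : ℝ) : ℂ))
      (by filter_upwards [h2.coeFn_toLp] with z hz
          rw [hz]; simp),
    integral_complex_ofReal, integral_complex_ofReal, ← Complex.ofReal_neg]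
  congr 1
  have hz : ∀ z ∉ Ω, ψ z = 0 := fun z hz =>
    image_eq_zero_of_notMem_tsupport fun h => hz (hψ.tsupport_subset h)
  have hz' : ∀ z ∉ Ω, fderiv ℝ ψ z e = 0 := fun z hz => by
    have : z ∉ tsupport (fderiv ℝ ψ) :=
      fun h => hz (hψ.tsupport_subset (tsupport_fderiv_subset ℝ h))
    rw [image_eq_zero_of_notMem_tsupport this]
    rfl
  rw [setIntegral_eq_integral_of_forall_compl_eq_zero fun z h => by simp [hz' z h],
    setIntegral_eq_integral_of_forall_compl_eq_zero fun z h => by simp [hz z h]]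
  have hwe : Continuous fun z => fderiv ℝ w z e :=
    (hw.continuous_fderiv (by simp)).clm_apply continuous_const
  rw [integral_mul_fderiv_eq_neg_fderiv_mul_of_integrable (μ := volume) (f := ψ) (g := w) (v := e)
    (((hψ.continuous_fderiv_apply e).mul hw.continuous).integrable_of_hasCompactSupport
      (hψ.hasCompactSupport_fderiv_apply e).mul_right)
    ((hψ.contDiff.continuous.mul hwe).integrable_of_hasCompactSupport
      hψ.hasCompactSupport.mul_right)
    ((hψ.contDiff.continuous.mul hw.continuous).integrable_of_hasCompactSupport
      hψ.hasCompactSupport.mul_right)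
    (fun x _ => hψ.contDiff.differentiable (by simp) x)
    (fun x _ => hw.differentiable (by simp) x), neg_neg]

theorem memLp_ofReal_of_bounded [IsFiniteMeasure (volume.restrict Ω)] {w : ℝ × ℝ → ℝ}
    (hw : Continuous w) {C : ℝ} (hC : ∀ z, |w z| ≤ C) :
    MemLp (fun z => (w z : ℂ)) 2 (volume.restrict Ω) :=
  MemLp.of_bound (Complex.continuous_ofReal.comp hw).aestronglyMeasurable C
    (Filter.Eventually.of_forall fun z => by simpa using hC z)

theorem norm_sq_toLp_ofReal {w : ℝ × ℝ → ℝ} (h : MemLp (fun z => (w z : ℂ)) 2 (volume.restrict Ω)) :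
    ‖h.toLp‖ ^ 2 = ∫ z in Ω, w z ^ 2 := by
  have h1 : ((‖h.toLp‖ ^ 2 : ℝ) : ℂ) = ((∫ z in Ω, w z ^ 2 : ℝ) : ℂ) := by
    rw [← integral_complex_ofReal]
    push_cast
    refine (inner_self_eq_norm_sq_to_K (𝕜 := ℂ) (h.toLp)).symm.trans ?_
    rw [L2.inner_def]
    refine integral_congr_ae ?_
    filter_upwards [h.coeFn_toLp] with z hz
    rw [hz]
    simp only [RCLike.inner_apply, Complex.conj_ofReal, sq]
  exact_mod_cast h1

/-- A function of the first variable as an element of `H¹(Ω)`. -/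
theorem exists_H1_of_contDiff [IsFiniteMeasure (volume.restrict Ω)] {h : ℝ → ℝ}
    (hh : ContDiff ℝ ∞ h) {C C' : ℝ} (hC : ∀ x, |h x| ≤ C) (hC' : ∀ x, |deriv h x| ≤ C') :
    ∃ U : H1 Ω, (embedding Ω U =ᵐ[volume.restrict Ω] fun z => (h z.1 : ℂ)) ∧
      ‖embedding Ω U‖ ^ 2 = ∫ z in Ω, h z.1 ^ 2 ∧
      ‖U‖ ^ 2 = ‖embedding Ω U‖ ^ 2 + ∫ z in Ω, deriv h z.1 ^ 2 := by
  have hw : ContDiff ℝ ∞ fun z : ℝ × ℝ => h z.1 := hh.comp contDiff_fst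
  have hfd : ∀ z e : ℝ × ℝ, fderiv ℝ (fun z : ℝ × ℝ => h z.1) z e = deriv h z.1 * e.1 := by
    intro z e
    have h1 : HasDerivAt h (deriv h z.1) z.1 :=
      (hh.differentiable (by simp) z.1).hasDerivAt
    have h2 := h1.hasFDerivAt.comp z hasFDerivAt_fst
    rw [HasFDerivAt.fderiv (f := fun z : ℝ × ℝ => h z.1) h2]
    simp [mul_comm]
  have m0 : MemLp (fun z : ℝ × ℝ => (h z.1 : ℂ)) 2 (volume.restrict Ω) :=
    memLp_ofReal_of_bounded hw.continuous fun z => hC z.1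
  have m1 : ∀ e : ℝ × ℝ, MemLp (fun z => ((fderiv ℝ (fun z : ℝ × ℝ => h z.1) z e : ℝ) : ℂ)) 2
      (volume.restrict Ω) := fun e =>
    memLp_ofReal_of_bounded (C := C' * |e.1|)
      ((hw.continuous_fderiv (by simp)).clm_apply continuous_const) fun z => by
        rw [hfd, abs_mul]
        exact mul_le_mul_of_nonneg_right (hC' _) (abs_nonneg _)
  let U : H1 Ω := ⟨WithLp.toLp 2 ![m0.toLp, (m1 (1, 0)).toLp, (m1 (0, 1)).toLp],
    hasWeakPartial_of_contDiff hw _ m0 (m1 _), hasWeakPartial_of_contDiff hw _ m0 (m1 _)⟩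
  have hU : embedding Ω U = m0.toLp := rfl
  refine ⟨U, ?_, ?_, ?_⟩
  · rw [hU]
    exact m0.coeFn_toLp
  · rw [hU, norm_sq_toLp_ofReal]
  · have h1 : ‖U‖ ^ 2 = ‖m0.toLp‖ ^ 2 + ‖(m1 (1, 0)).toLp‖ ^ 2 + ‖(m1 (0, 1)).toLp‖ ^ 2 := by
      change ‖U.1‖ ^ 2 = _
      rw [PiLp.norm_sq_eq_of_L2, Fin.sum_univ_three]
      rfl
    rw [h1, hU, norm_sq_toLp_ofReal, norm_sq_toLp_ofReal, norm_sq_toLp_ofReal]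
    simp [hfd]

end SmoothFunctions

/-! ### Norm and energy of the room functions -/

section RoomFunctions

variable {d dh β : ℕ → ℝ}

/-- The profile equal to `1` on the room with index `k + 1` and supported between the left end of
the passage with index `k` and the right end of the passage with index `k + 1`. -/
noncomputable def roomProfile (d dh : ℕ → ℝ) (k : ℕ) : ℝ → ℝ :=
  plateau (abscissa d dh k) (abscissa d dh (k + 1) + dh (k + 1)) (dh k) (dh (k + 1))

/-- Profiles with consecutive indices overlap in their common passage, hence the gap in the indices.
-/
theorem roomProfile_mul_eq_zero (hd : ∀ k, 0 < d k) (hdh : ∀ k, 0 < dh k) {j k : ℕ}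
    (hjk : j + 1 < k) (x : ℝ) : roomProfile d dh j x * roomProfile d dh k x = 0 := by
  have h := abscissa_add_le (d := d) (dh := dh) hd hdh hjk
  rcases le_total x (abscissa d dh k) with hx | hx
  · rw [roomProfile, roomProfile, plateau_eq_zero_of_le (hdh k) hx, mul_zero]
  · rw [roomProfile, plateau_eq_zero_of_ge (hdh (j + 1)), zero_mul]
    linarith [hd k]

theorem sq_le_integral_roomProfile (hd : ∀ k, 0 < d k) (hdh : ∀ k, 0 < dh k)
    [IsFiniteMeasure (volume.restrict (domain d dh β))] (k : ℕ) :
    d (k + 1) ^ 2 ≤ ∫ z in domain d dh β, roomProfile d dh k z.1 ^ 2 := by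
  have hsub : room d dh (k + 1) ⊆ domain d dh β := fun z hz => Set.mem_iUnion.2 ⟨k + 1, Or.inl hz⟩
  have hmeas : MeasurableSet (room d dh (k + 1)) := measurableSet_Ioo.prod measurableSet_Ioo
  have hint : IntegrableOn (fun z : ℝ × ℝ => roomProfile d dh k z.1 ^ 2) (domain d dh β) := by
    refine Integrable.of_bound (C := 1)
      ((contDiff_plateau.continuous.comp continuous_fst).pow 2).aestronglyMeasurable
      (Filter.Eventually.of_forall fun z => ?_)
    rw [Real.norm_eq_abs, abs_of_nonneg (sq_nonneg _)]
    exact pow_le_one₀ plateau_nonneg plateau_le_one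
  refine le_trans ?_ (setIntegral_mono_set hint
    (Filter.Eventually.of_forall fun z => sq_nonneg _) hsub.eventuallyLE)
  rw [setIntegral_congr_fun (g := fun _ => (1 : ℝ)) hmeas, setIntegral_const, smul_eq_mul, mul_one,
    volume_room _ (hd _).le]
  rintro z ⟨⟨h1, h2⟩, -⟩
  rw [abscissa_succ] at h1
  simp only
  rw [roomProfile, plateau_eq_one (hdh k) (hdh _) (by linarith) (by linarith), one_pow]

/-- The squared slope is of order `M ^ 2 / dh ^ 2` on a passage of area `dh * β`, whence `β / dh`;
outside the two passages the derivative vanishes on the domain. -/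
theorem integral_deriv_roomProfile_le (hd : ∀ k, 0 < d k) (hdh : ∀ k, 0 < dh k)
    (hβ : ∀ k, 0 < β k) (hΩ : MeasurableSet (domain d dh β))
    [IsFiniteMeasure (volume.restrict (domain d dh β))] {M : ℝ}
    (hM : ∀ t, |deriv Real.smoothTransition t| ≤ (Set.Icc (0 : ℝ) 1).indicator (fun _ => M) t)
    (k : ℕ) :
    ∫ z in domain d dh β, deriv (roomProfile d dh k) z.1 ^ 2 ≤
      2 * M ^ 2 * (β k / dh k + β (k + 1) / dh (k + 1)) := by
  have hmeas : ∀ j, MeasurableSet (passage d dh β j) := fun j =>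
    measurableSet_Icc.prod measurableSet_Ioo
  have hind : ∀ j c, Integrable ((passage d dh β j).indicator fun _ => (c : ℝ))
      (volume.restrict (domain d dh β)) := fun j c => (integrable_const c).indicator (hmeas j)
  have hval : ∀ j c, ∫ z in domain d dh β, (passage d dh β j).indicator (fun _ => (c : ℝ)) z =
      dh j * β j * c := by
    intro j c
    have hsub : passage d dh β j ⊆ domain d dh β := fun z hz => Set.mem_iUnion.2 ⟨j, Or.inr hz⟩
    rw [integral_indicator (hmeas j), Measure.restrict_restrict (hmeas j),
      Set.inter_eq_left.2 hsub, setIntegral_const, volume_passage (hdh j).le (hβ j).le, smul_eq_mul]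
  have hle : ∀ z ∈ domain d dh β, deriv (roomProfile d dh k) z.1 ^ 2 ≤
      (passage d dh β k).indicator (fun _ => 2 * (M / dh k) ^ 2) z +
      (passage d dh β (k + 1)).indicator (fun _ => 2 * (M / dh (k + 1)) ^ 2) z := by
    intro z hz
    refine (sq_deriv_plateau_le (hdh k) (hdh (k + 1)) hM).trans (add_le_add ?_ ?_)
    · refine Set.indicator_apply_le' (fun h => ?_)
        fun _ => Set.indicator_nonneg (fun _ _ => by positivity) _
      rw [Set.indicator_of_mem (mem_passage_of_mem_domain hd hdh hz h.1 h.2)]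
    · refine Set.indicator_apply_le' (fun h => ?_)
        fun _ => Set.indicator_nonneg (fun _ _ => by positivity) _
      rw [add_sub_cancel_right] at h
      rw [Set.indicator_of_mem (mem_passage_of_mem_domain hd hdh hz h.1 h.2)]
  calc ∫ z in domain d dh β, deriv (roomProfile d dh k) z.1 ^ 2
      ≤ ∫ z in domain d dh β, ((passage d dh β k).indicator (fun _ => 2 * (M / dh k) ^ 2) z +
          (passage d dh β (k + 1)).indicator (fun _ => 2 * (M / dh (k + 1)) ^ 2) z) := by
        refine integral_mono_of_nonneg (Filter.Eventually.of_forall fun z => sq_nonneg _)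
          ((hind _ _).add (hind _ _)) ?_
        filter_upwards [ae_restrict_mem hΩ] with z hz using hle z hz
    _ = 2 * M ^ 2 * (β k / dh k + β (k + 1) / dh (k + 1)) := by
        rw [integral_add (hind _ _) (hind _ _), hval, hval]
        have := (hdh k).ne'
        have := (hdh (k + 1)).ne'
        field_simp

theorem exists_orthonormal_bounded (hd : ∀ k, 0 < d k) (hdh : ∀ k, 0 < dh k)
    (hβ : ∀ k, 0 < β k) (hΩ : MeasurableSet (domain d dh β))
    [IsFiniteMeasure (volume.restrict (domain d dh β))] {C₁ C : ℝ}
    (hdd : ∀ k, dh k ≤ C₁ * min (d k) (d (k + 1))) (hC₁ : 0 < C₁) (hC : 0 < C)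
    (hβC : ∀ k, β k ≤ C * dh k ^ 3) :
    ∃ (V : ℕ → H1 (domain d dh β)) (K : ℝ),
      (Orthonormal ℂ fun k => embedding (domain d dh β) (V k)) ∧ ∀ k, ‖V k‖ ≤ K := by
  obtain ⟨M, hM⟩ := exists_abs_deriv_smoothTransition_le
  have hex : ∀ k, ∃ U : H1 (domain d dh β),
      (embedding (domain d dh β) U =ᵐ[volume.restrict (domain d dh β)]
        fun z => (roomProfile d dh k z.1 : ℂ)) ∧
      ‖embedding (domain d dh β) U‖ ^ 2 = ∫ z in domain d dh β, roomProfile d dh k z.1 ^ 2 ∧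
      ‖U‖ ^ 2 = ‖embedding (domain d dh β) U‖ ^ 2 +
        ∫ z in domain d dh β, deriv (roomProfile d dh k) z.1 ^ 2 := by
    intro k
    -- This derivative bound depends on `k` and only ensures membership in `H¹`; the uniform
    -- estimate is integral, not pointwise.
    refine exists_H1_of_contDiff contDiff_plateau (C := 1)
      (C' := √(2 * (M / dh k) ^ 2 + 2 * (M / dh (k + 1)) ^ 2))
      (fun x => (abs_of_nonneg plateau_nonneg).trans_le plateau_le_one) fun x => Real.abs_le_sqrt ?_
    refine (sq_deriv_plateau_le (hdh k) (hdh (k + 1)) hM).trans (add_le_add ?_ ?_) <;>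
      exact Set.indicator_apply_le' (fun _ => le_rfl) fun _ => by positivity
  choose U hU hU0 hU1 using hex
  have hlow : ∀ k, d (k + 1) ^ 2 ≤ ‖embedding (domain d dh β) (U k)‖ ^ 2 := fun k => by
    rw [hU0]
    exact sq_le_integral_roomProfile hd hdh k
  -- One factor `dh j` of the cube cancels; the other two are compared with the side of the room.
  have hratio : ∀ j k, dh j ≤ C₁ * d k → β j / dh j ≤ C * C₁ ^ 2 * d k ^ 2 := by
    intro j k hjk
    have hj := hdh j
    rw [div_le_iff₀ hj]
    calc β j ≤ C * dh j ^ 3 := hβC j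
      _ = C * dh j ^ 2 * dh j := by ring
      _ ≤ C * (C₁ * d k) ^ 2 * dh j := by gcongr
      _ = _ := by ring
  have hup : ∀ k, ‖U k‖ ^ 2 ≤
      (1 + 4 * M ^ 2 * C * C₁ ^ 2) * ‖embedding (domain d dh β) (U k)‖ ^ 2 := by
    intro k
    have h1 := hratio k (k + 1) ((hdd k).trans (by gcongr; exact min_le_right _ _))
    have h2 := hratio (k + 1) (k + 1) ((hdd (k + 1)).trans (by gcongr; exact min_le_left _ _))
    rw [hU1, one_add_mul]
    gcongr
    calc _ ≤ 2 * M ^ 2 * (β k / dh k + β (k + 1) / dh (k + 1)) :=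
          integral_deriv_roomProfile_le hd hdh hβ hΩ hM k
      _ ≤ 2 * M ^ 2 * (C * C₁ ^ 2 * d (k + 1) ^ 2 + C * C₁ ^ 2 * d (k + 1) ^ 2) := by gcongr
      _ = 4 * M ^ 2 * C * C₁ ^ 2 * d (k + 1) ^ 2 := by ring
      _ ≤ _ := mul_le_mul_of_nonneg_left (hlow k) (by positivity)
  have horth : ∀ j k, j + 1 < k →
      inner ℂ (embedding (domain d dh β) (U j)) (embedding (domain d dh β) (U k)) = 0 := by
    intro j k hjk
    rw [L2.inner_def]
    refine integral_eq_zero_of_ae ?_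
    filter_upwards [hU j, hU k] with z h1 h2
    rw [h1, h2]
    have := roomProfile_mul_eq_zero hd hdh hjk z.1
    simp only [RCLike.inner_apply, Complex.conj_ofReal, Pi.zero_apply]
    rw [← Complex.ofReal_mul, mul_comm, this, Complex.ofReal_zero]
  suffices h : ∃ V : ℕ → H1 (domain d dh β),
      (Orthonormal ℂ fun k => embedding (domain d dh β) (V k)) ∧
        ∀ k, ‖V k‖ ≤ √(1 + 4 * M ^ 2 * C * C₁ ^ 2) from
    let ⟨V, hV⟩ := h; ⟨V, _, hV⟩
  -- Even indices differ by at least 2, so the chosen profiles have products equal to zero.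
  refine exists_orthonormal_of_rayleigh_le (U := fun k => U (2 * k))
    (fun k h0 => ?_) (fun j k hjk => ?_) fun k => ?_
  · have h1 := hlow (2 * k)
    rw [h0, norm_zero] at h1
    have := pow_pos (hd (2 * k + 1)) 2
    linarith
  · rcases hjk.lt_or_gt with h | h
    · exact horth _ _ (by omega)
    · exact inner_eq_zero_symm.1 (horth _ _ (by omega))
  · refine abs_le_of_sq_le_sq' ?_ (by positivity) |>.2
    rw [mul_pow, Real.sq_sqrt (by positivity)]
    exact hup _

end RoomFunctions

end RoomsPassages

theorem mainTheorem6 (d dh β : ℕ → ℝ) (C₁ C₂ α : ℝ)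
    (hd : ∀ k, 0 < d k) (hdh : ∀ k, 0 < dh k) (hβ : ∀ k, 0 < β k)
    (hsum : Summable d)
    (hC₁ : 0 < C₁) (hdd : ∀ k, dh k ≤ C₁ * min (d k) (d (k + 1)))
    (hα : 3 ≤ α) (hC₂ : 0 < C₂) (hβC : ∀ k, β k ≤ C₂ * dh k ^ α)
    (hC₂max : C₂ ≤ 1 / C₁ * (⨆ k, dh k) ^ (1 - α)) :
    IsOpen (RoomsPassages.domain d dh β) ∧
    IsConnected (RoomsPassages.domain d dh β) ∧
    Bornology.IsBounded (RoomsPassages.domain d dh β) ∧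
    ¬ IsCompactOperator (RoomsPassages.embedding (RoomsPassages.domain d dh β)) ∧
    IsSelfAdjoint (RoomsPassages.neumannLaplacian (RoomsPassages.domain d dh β)) ∧
    (RoomsPassages.essentialSpectrum
      (RoomsPassages.neumannLaplacian (RoomsPassages.domain d dh β))).Nonempty := by
  have hle : ∀ k, dh k ≤ C₁ * d k := fun k =>
    (hdd k).trans (mul_le_mul_of_nonneg_left (min_le_left _ _) hC₁.le)
  -- Summability bounds `dh`, so `⨆ k, dh k` is a true supremum and not the default value 0.
  have hsum' : Summable dh :=
    Summable.of_nonneg_of_le (fun k => (hdh k).le) hle (hsum.mul_left C₁)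
  have hβmin : ∀ k, β k ≤ min (d k) (d (k + 1)) := fun k => by
    refine (RoomsPassages.width_le_length_div C₁ C₂ α hdh hsum' hC₁ hα hβC hC₂max k).trans ?_
    rw [div_le_iff₀ hC₁, mul_comm]
    exact hdd k
  have hβd : ∀ k, β k ≤ d k := fun k => (hβmin k).trans (min_le_left _ _)
  have hβd' : ∀ k, β k ≤ d (k + 1) := fun k => (hβmin k).trans (min_le_right _ _)
  have hopen := RoomsPassages.isOpen_domain (dh := dh) hd hβd hβd'
  have hbdd := RoomsPassages.isBounded_domain hd hdh hβd hsum hsum'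
  have : IsFiniteMeasure (volume.restrict (RoomsPassages.domain d dh β)) :=
    isFiniteMeasure_restrict.2 hbdd.measure_lt_top.ne
  obtain ⟨C, hC, hcube⟩ := RoomsPassages.exists_width_le_mul_cube C₂ α hdh hsum' hα hC₂ hβC
  obtain ⟨V, K, hV, hK⟩ := RoomsPassages.exists_orthonormal_bounded hd hdh hβ
    hopen.measurableSet hdd hC₁ hC hcube
  exact ⟨hopen, RoomsPassages.isConnected_domain hd hdh hβ hβd hβd', hbdd,
    RoomsPassages.not_isCompactOperator_embedding hV hK,
    RoomsPassages.isSelfAdjoint_neumannLaplacian hopen,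
    RoomsPassages.essentialSpectrum_neumannLaplacian_nonempty hopen hV hK⟩
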